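/- Let $V=\{1,\dots,d\}$, let $G,H:2^V\to\mathbb{R}$ be normalized ($G(\emptyset)=H(\emptyset)=0$) submodular set functions, and let $F=G-H$. Let $g_L,h_L:\mathbb{R}^d\to\mathbb{R}$ be the Lovász extensions of $G$ and $H$, let $\rho\ge 0$, $\epsilon_x\ge 0$, and put $$g=g_L+\delta_{[0,1]^d}+\tfrac{\rho}{2}\|\cdot\|^2,\qquad h=h_L+\tfrac{\rho}{2}\|\cdot\|^2,\qquad f=g-h,$$ where $\|\cdot\|$ is the Euclidean norm and $\delta_{[0,1]^d}$ is $0$ on $[0,1]^d$ and $+\infty$ elsewhere. For a permutation $\sigma$ of $V$ write $S^\sigma_\ell=\{\sigma(1),\dots,\sigma(\ell)\}$ and $S^\sigma_0=\emptyset$; $\sigma$ is a decreasing order of $x\in\mathbb{R}^d$ if $x_{\sigma(1)}\ge\dots\ge x_{\sigma(d)}$. The greedy vector $s(\sigma)\in\mathbb{R}^d$ is given by $s(\sigma)_{\sigma(j)}=H(S^\sigma_{j})-H(S^\sigma_{j-1})$. For $\epsilon\ge0$ let $$\epsilon'=\begin{cases}\sqrt{2\rho d(\epsilon+\epsilon_x)}&\text{if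 }\epsilon+\epsilon_x\le\tfrac{\rho d}{2},\\ \tfrac{\rho d}{2}+\epsilon+\epsilon_x&\text{otherwise.}\end{cases}$$ (a) Let $x^0,x^1,\dots$ and $y^0,y^1,\dots$ be the iterates of a finite or infinite run of the approximate difference-of-convex algorithm in which, at each iteration $k$ that is performed, $x^k=\mathbf{1}_{X^k}$ for some $X^k\subseteq V$, $y^k=\rho x^k+s(\sigma^k)$ for a decreasing order $\sigma^k$ of $x^k$, and $x^{k+1}$ is an $\epsilon_x$-solution of $\min_{x\in[0,1]^d} g_L(x)-\langle x,y^k\rangle+\tfrac{\rho}{2}\|x\|^2$. Then for every iteration $k$ and every $\epsilon\ge 0$: if $f(x^k)-f(x^{k+1})\le\epsilon$, then $$F(X^k)\le F(S^{\sigma^k}_\ell)+\epsilon'\quad\text{for all }\ell\in\{0,1,\dots,d\}.$$ (b) Suppose instead that, at each iteration $k$ that is performed, $x^k=\mathbf{1}_{X^k}$, and $d$ decreasing orders $\sigma^k_1,\dots,\sigma^k_d$ of $x^k$ are given such that every $j\in X^k$ equals $\sigma^k_i(|X^k|)$ for some $i$ and every $j\in V\setminus X^k$ equals $\sigma^k_i(|X^k|+1)$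 for some $i$; that $y^k_i=\rho x^k+s(\sigma^k_i)$; that candidates $x^{k+1}_i\in\partial_{\epsilon_x}g^*(y^k_i)$ are chosen for all $i\in V$, where $g^*$ is the Fenchel conjugate of $g$ and $\partial_{\epsilon_x}$ the $\epsilon_x$-subdifferential; and that $x^{k+1}$ is one of the candidates $x^{k+1}_1,\dots,x^{k+1}_d$ with the smallest value of $f$. Then for every iteration $k$ and every $\epsilon\ge0$: if $f(x^k)-f(x^{k+1})\le\epsilon$, then $F(X^k)\le F(S^{\sigma^k_i}_\ell)+\epsilon'$ for all $i\in V$ and all $\ell\in\{0,1,\dots,d\}$, and $X^k$ is an $\epsilon'$-local minimum of $F$, i.e. $F(X^k)\le F(X^k\cup\{j\})+\epsilon'$ for all $j\in V\setminus X^k$ and $F(X^k)\le F(X^k\setminus\{j\})+\epsilon'$ for all $j\in X^k$. -/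

import Mathlib

namespace DSMin

noncomputable section

/-- The Euclidean space `ℝ^d`, with the `ℓ₂`-norm. -/
abbrev Vec (d : ℕ) : Type := EuclideanSpace ℝ (Fin d)

/-- A set function on the ground set `V`, modelled by `Fin d`. -/
abbrev SetFun (d : ℕ) : Type := Finset (Fin d) → ℝ

variable {d : ℕ}

/-- The marginal gain `F(i | X) = F(X ∪ {i}) - F(X)`. -/
def marginalGain (F : SetFun d) (i : Fin d) (X : Finset (Fin d)) : ℝ :=
  F (insert i X) - F X

/-- `F(∅) = 0`. -/
def IsNormalized (F : SetFun d) : Prop := F ∅ = 0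

/-- Diminishing marginal gains. -/
def IsSubmodular (F : SetFun d) : Prop :=
  ∀ X Y : Finset (Fin d), X ⊆ Y → ∀ i, i ∉ Y → marginalGain F i Y ≤ marginalGain F i X

/-- The indicator vector of a set. -/
def indVec (X : Finset (Fin d)) : Vec d :=
  WithLp.toLp 2 (fun i => if i ∈ X then (1 : ℝ) else 0)

/-- The set `S^σ_k = {σ(1), …, σ(k)}` of the first `k` elements in the order `σ`
(positions are counted from `0` in `Fin d`). -/
def prefixSet (σ : Equiv.Perm (Fin d)) (k : ℕ) : Finset (Fin d) :=
  Finset.univ.filter (fun i => ((σ.symm i : Fin d) : ℕ) < k)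

/-- `σ` is a decreasing order of `x`: `x_{σ(1)} ≥ … ≥ x_{σ(d)}`. -/
def IsDecreasingOrder (σ : Equiv.Perm (Fin d)) (x : Vec d) : Prop :=
  Antitone (fun k => x (σ k))

/-- The sum `∑ₖ x_{σ(k)} F(σ(k) | S^σ_{k-1})`. -/
def lovaszSum (F : SetFun d) (σ : Equiv.Perm (Fin d)) (x : Vec d) : ℝ :=
  ∑ k : Fin d, x (σ k) * marginalGain F (σ k) (prefixSet σ k)

/-- A decreasing order of `x`. -/
def sortPerm (x : Vec d) : Equiv.Perm (Fin d) := Tuple.sort (fun i => -(x i))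

theorem sortPerm_isDecreasingOrder (x : Vec d) : IsDecreasingOrder (sortPerm x) x := by
  intro a b hab
  have h := Tuple.monotone_sort (fun i => -(x i)) hab
  simpa [sortPerm] using h

/-- The Lovász extension of a set function (see `lovasz_eq` for the independence of the
chosen decreasing order). -/
def lovasz (F : SetFun d) (x : Vec d) : ℝ := lovaszSum F (sortPerm x) x

theorem insert_prefixSet (σ : Equiv.Perm (Fin d)) (k : Fin d) :
    insert (σ k) (prefixSet σ k) = prefixSet σ ((k : ℕ) + 1) := by
  ext i
  simp only [prefixSet, Finset.mem_insert, Finset.mem_filter, Finset.mem_univ, true_and]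
  rw [← Equiv.symm_apply_eq, Fin.ext_iff]
  omega

/-- Any decreasing order of `x` computes the Lovász extension at `x`. -/
theorem lovasz_eq (F : SetFun d) (x : Vec d) (σ : Equiv.Perm (Fin d))
    (hσ : IsDecreasingOrder σ x) : lovasz F x = lovaszSum F σ x := by
  have hτ := sortPerm_isDecreasingOrder x
  unfold lovasz
  set τ := sortPerm x
  have hac : ∀ k, x (τ k) = x (σ k) := fun k =>
    congrFun (Tuple.unique_antitone (f := fun i => x i) hτ hσ) k
  rw [← sub_eq_zero]
  unfold lovaszSum
  rw [← Finset.sum_sub_distrib]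
  set D : ℕ → ℝ := fun k => F (prefixSet τ k) - F (prefixSet σ k) with hD
  have hterm : ∀ k : Fin d, x (τ k) * marginalGain F (τ k) (prefixSet τ k)
      - x (σ k) * marginalGain F (σ k) (prefixSet σ k)
      = x (σ k) * (D (k + 1) - D k) := by
    intro k
    simp only [marginalGain, insert_prefixSet, hac, hD]
    ring
  rw [Finset.sum_congr rfl (fun k _ => hterm k)]
  have hlev : ∀ ρ : Equiv.Perm (Fin d), IsDecreasingOrder ρ x → ∀ n (h : n + 1 < d),
      x (ρ ⟨n + 1, h⟩) < x (ρ ⟨n, by omega⟩) →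
      prefixSet ρ (n + 1) = Finset.univ.filter (fun i => x (ρ ⟨n, by omega⟩) ≤ x i) := by
    intro ρ hρ n h hlt
    ext i
    simp only [prefixSet, Finset.mem_filter, Finset.mem_univ, true_and]
    constructor
    · intro hi
      have := hρ (show ρ.symm i ≤ ⟨n, by omega⟩ from Fin.le_def.2 (Nat.lt_succ_iff.1 hi))
      simpa using this
    · intro hi
      by_contra hc
      have := hρ (show (⟨n + 1, h⟩ : Fin d) ≤ ρ.symm i from Fin.le_def.2 (not_lt.1 hc))
      simp only [Equiv.apply_symm_apply] at this
      linarith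
  have hD0 : D 0 = 0 := by simp [hD, prefixSet]
  have hDd : D d = 0 := by simp [hD, prefixSet]
  let a : ℕ → ℝ := fun k => if h : k < d then x (σ ⟨k, h⟩) else 0
  have hsum : ∑ k : Fin d, x (σ k) * (D (k + 1) - D k)
      = ∑ k ∈ Finset.range d, a k * (D (k + 1) - D k) := by
    rw [← Fin.sum_univ_eq_sum_range (fun k => a k * (D (k + 1) - D k)) d]
    refine Finset.sum_congr rfl (fun k _ => ?_)
    simp [a]
  rw [hsum]
  have hind : ∀ n, n < d →
      ∑ k ∈ Finset.range (n + 1), a k * (D (k + 1) - D k) = a n * D (n + 1) := by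
    intro n
    induction n with
    | zero => intro _; simp [hD0]
    | succ n ih =>
      intro hn
      rw [Finset.sum_range_succ, ih (by omega)]
      have hn' : n < d := by omega
      have hz : (a n - a (n + 1)) * D (n + 1) = 0 := by
        have han : a n = x (σ ⟨n, hn'⟩) := by simp [a, hn']
        have han1 : a (n + 1) = x (σ ⟨n + 1, hn⟩) := by simp [a, hn]
        have hle : x (σ ⟨n + 1, hn⟩) ≤ x (σ ⟨n, hn'⟩) :=
          hσ (Fin.mk_le_mk.2 (Nat.le_succ n))
        rcases hle.lt_or_eq with hlt | heq
        · have h1 := hlev σ hσ n hn hlt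
          have h2 := hlev τ hτ n hn (by simpa only [hac] using hlt)
          have : D (n + 1) = 0 := by
            simp only [hD, h1, h2, hac, sub_self]
          rw [this, mul_zero]
        · rw [han, han1, heq, sub_self, zero_mul]
      linarith
  cases d with
  | zero => simp
  | succ m => rw [hind m (Nat.lt_succ_self m), hDd, mul_zero]

/-- The vector of the greedy algorithm: `y_{σ(k)} = F(σ(k) | S^σ_{k-1})`. -/
def greedyVec (F : SetFun d) (σ : Equiv.Perm (Fin d)) : Vec d :=
  WithLp.toLp 2 (fun i => marginalGain F i (prefixSet σ (σ.symm i)))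

/-- The hypercube `[0,1]^d`. -/
def cube (d : ℕ) : Set (Vec d) := {x | ∀ i, 0 ≤ x i ∧ x i ≤ 1}

open Classical in
/-- The convex-analytic indicator function `δ_C`. -/
def setIndicator (C : Set (Vec d)) (x : Vec d) : EReal := if x ∈ C then 0 else ⊤

/-- The Fenchel conjugate `Φ*(y) = sup_x ⟨x, y⟩ - Φ(x)`. -/
def conjugate (Φ : Vec d → EReal) (y : Vec d) : EReal :=
  ⨆ x : Vec d, ((inner ℝ x y : ℝ) : EReal) - Φ x

/-- The `ε`-subdifferential of `Φ` at `x₀` (empty when `x₀` is outside the domain of `Φ`). -/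
def epsSubdiff (Φ : Vec d → EReal) (ε : ℝ) (x₀ : Vec d) : Set (Vec d) :=
  {y | Φ x₀ < ⊤ ∧ ∀ x, Φ x₀ + ((inner ℝ y (x - x₀) - ε : ℝ) : EReal) ≤ Φ x}

/-- `g = g_L + δ_{[0,1]^d} + (ρ/2)‖·‖²`. -/
def gReg (G : SetFun d) (ρ : ℝ) (x : Vec d) : EReal :=
  (lovasz G x : EReal) + setIndicator (cube d) x + ((ρ / 2 * ‖x‖ ^ 2 : ℝ) : EReal)

/-- `h = h_L + (ρ/2)‖·‖²`, which is finite everywhere. -/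
def hReg (H : SetFun d) (ρ : ℝ) (x : Vec d) : ℝ :=
  lovasz H x + ρ / 2 * ‖x‖ ^ 2

/-- The objective `f = g - h`. -/
def objective (G H : SetFun d) (ρ : ℝ) (x : Vec d) : EReal :=
  gReg G ρ x - (hReg H ρ x : EReal)

/-- `x` is an `ε`-solution of `min_{z ∈ C} φ(z)`. -/
def IsEpsSolution (φ : Vec d → ℝ) (C : Set (Vec d)) (ε : ℝ) (x : Vec d) : Prop :=
  x ∈ C ∧ ∀ z ∈ C, φ x ≤ φ z + ε

/-- `X` is an `ε`-local minimum of `F`. -/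
def IsEpsLocalMin (F : SetFun d) (ε : ℝ) (X : Finset (Fin d)) : Prop :=
  (∀ i, i ∉ X → F X ≤ F (insert i X) + ε) ∧ (∀ i ∈ X, F X ≤ F (X.erase i) + ε)

/-- The tolerance `ε'`. -/
def epsPrime (d : ℕ) (ρ ε εx : ℝ) : ℝ :=
  if ε + εx ≤ ρ * d / 2 then √(2 * ρ * d * (ε + εx)) else ρ * d / 2 + ε + εx

/-- The approximate DCA run for `f = g - h`, during the iterations `k < N` (`N = ⊤` for an
infinite run), with integral iterates `x^k = 1_{X^k}` and with `y^k - ρ x^k` given by the greedy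
algorithm for the decreasing order `σ^k` of `x^k`. -/
structure IsGreedyDCARun (G H : SetFun d) (ρ εx : ℝ) (N : ℕ∞) (x y : ℕ → Vec d)
    (X : ℕ → Finset (Fin d)) (σ : ℕ → Equiv.Perm (Fin d)) : Prop where
  integral : ∀ k : ℕ, (k : ℕ∞) < N → x k = indVec (X k)
  order : ∀ k : ℕ, (k : ℕ∞) < N → IsDecreasingOrder (σ k) (x k)
  greedy : ∀ k : ℕ, (k : ℕ∞) < N → y k - ρ • x k = greedyVec H (σ k)
  step : ∀ k : ℕ, (k : ℕ∞) < N →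
    IsEpsSolution (fun z => lovasz G z - inner ℝ z (y k) + ρ / 2 * ‖z‖ ^ 2) (cube d) εx (x (k + 1))

/-- Every element of `X` is at position `|X|` in one of the orders `σ_i`, and every element
outside `X` is at position `|X| + 1` in one of them (positions counted from `1`, so that
`p : Fin d` is the position `p + 1`). -/
def CoversBoundary (σ : Fin d → Equiv.Perm (Fin d)) (X : Finset (Fin d)) : Prop :=
  (∀ j ∈ X, ∃ i p : Fin d, (p : ℕ) + 1 = X.card ∧ σ i p = j) ∧
  (∀ j, j ∉ X → ∃ i p : Fin d, (p : ℕ) = X.card ∧ σ i p = j)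

/-- The variant that tries, in each iteration `k < N`, the `d` decreasing orders
`σ^k_1, …, σ^k_d` of `x^k`: it computes the subgradients `y^k_i ∈ ∂h(x^k)` greedily, picks
candidates `x^{k+1}_i ∈ ∂_{ε_x} g*(y^k_i)` (here `xc k i`), and lets `x^{k+1}` be a candidate of
least objective value. -/
structure IsMultiGreedyDCARun (G H : SetFun d) (ρ εx : ℝ) (N : ℕ∞) (x : ℕ → Vec d)
    (y xc : ℕ → Fin d → Vec d) (X : ℕ → Finset (Fin d))
    (σ : ℕ → Fin d → Equiv.Perm (Fin d)) : Prop where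
  integral : ∀ k : ℕ, (k : ℕ∞) < N → x k = indVec (X k)
  order : ∀ k : ℕ, (k : ℕ∞) < N → ∀ i, IsDecreasingOrder (σ k i) (x k)
  covers : ∀ k : ℕ, (k : ℕ∞) < N → CoversBoundary (σ k) (X k)
  greedy : ∀ k : ℕ, (k : ℕ∞) < N → ∀ i, y k i - ρ • x k = greedyVec H (σ k i)
  candidate : ∀ k : ℕ, (k : ℕ∞) < N → ∀ i,
    xc k i ∈ epsSubdiff (conjugate (gReg G ρ)) εx (y k i)
  best : ∀ k : ℕ, (k : ℕ∞) < N → ∃ i₀, x (k + 1) = xc k i₀ ∧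
    ∀ i, objective G H ρ (xc k i₀) ≤ objective G H ρ (xc k i)

end

end DSMin

open DSMin

/-!
Everything rests on two facts about the greedy vector `s(σ)` of a normalized set function `F`.
If `σ` is a decreasing order of `x`, then the Lovász extension at `x` is `⟨s(σ), x⟩`, so it is
linear on the cone of all vectors ordered by `σ` (`lovasz_eq_inner_greedyVec`). If `F` is moreover
submodular, then `⟨s(σ), z⟩` minorizes the Lovász extension everywhere, whatever the order
(`inner_greedyVec_le_lovasz`), so that `s(σ)` is a subgradient at every vector ordered by `σ`.

Let `x` be the indicator vector of `X`, let `φ` be the convex model minimized by the step, and let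
`x'` be an `ε_x`-solution. Since `y` is a subgradient of `h` at `x`, the inequality
`f x - f x' ≤ ε` gives `φ x ≤ φ x' + ε`, so `x` itself minimizes `φ` up to `ε + ε_x`
(`isEpsSolution_of_objective_sub_le`). Both `x` and the indicator vector `w` of a prefix of `σ` are
ordered by `σ`, hence along the segment from `x` to `w` the model `φ` is an explicit quadratic:
its slope at `x` is the difference of the values of `F = G - H`, and its curvature is
`ρ‖w - x‖² ≤ ρ d`. Optimizing the step length in `[0, 1]` (`le_epsPrime_of_forall_step`)
yields `F X ≤ F (S^σ_ℓ) + ε'`.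

For the variant with several orders, an `ε_x`-subgradient `x'` of `g*` at `y` is an `ε_x`-solution
of the same minimization (`isEpsSolution_of_mem_epsSubdiff_conjugate`). The general biconjugation
theorem is not needed for this: testing the `ε_x`-subgradient inequality along the coordinate axes
forces `x'` into the cube, and testing it at the explicit subgradient `ρ x' + s(τ)` of `g` at `x'`
gives the bound. Since the selected candidate has the least objective value, the first part applies
to every candidate, and neighbours of `X` are prefixes of the orders because `X` itself is the
prefix of length `|X|`.
-/

namespace DSMin

variable {d : ℕ}

/-! ### Prefixes and indicator vectors -/

theorem mem_prefixSet {σ : Equiv.Perm (Fin d)} {n : ℕ} {i : Fin d} :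
    i ∈ prefixSet σ n ↔ ((σ.symm i : Fin d) : ℕ) < n := by
  simp [prefixSet]

theorem prefixSet_zero (σ : Equiv.Perm (Fin d)) : prefixSet σ 0 = ∅ := by
  simp [prefixSet]

theorem prefixSet_top (σ : Equiv.Perm (Fin d)) : prefixSet σ d = Finset.univ := by
  simp [prefixSet]

theorem apply_notMem_prefixSet (σ : Equiv.Perm (Fin d)) (p : Fin d) :
    σ p ∉ prefixSet σ p := by
  simp [mem_prefixSet]

theorem card_prefixSet (σ : Equiv.Perm (Fin d)) {n : ℕ} (hn : n ≤ d) :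
    (prefixSet σ n).card = n := by
  induction n with
  | zero => simp [prefixSet_zero]
  | succ n ih =>
    have h := insert_prefixSet σ ⟨n, hn⟩
    have h' := apply_notMem_prefixSet σ ⟨n, hn⟩
    simp only at h h'
    rw [← h, Finset.card_insert_of_notMem h', ih (by omega)]

theorem indVec_apply (X : Finset (Fin d)) (i : Fin d) :
    indVec X i = if i ∈ X then (1 : ℝ) else 0 := rfl

theorem indVec_mem_cube (X : Finset (Fin d)) : indVec X ∈ cube d := by
  intro i
  rw [indVec_apply]
  split_ifs <;> norm_num

theorem isDecreasingOrder_indVec_prefixSet (σ : Equiv.Perm (Fin d)) (n : ℕ) :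
    IsDecreasingOrder σ (indVec (prefixSet σ n)) := by
  intro a b hab
  have hab' : (a : ℕ) ≤ b := hab
  simp only [indVec_apply, mem_prefixSet, Equiv.symm_apply_apply]
  split_ifs
  · exact le_rfl
  · omega
  · exact zero_le_one
  · exact le_rfl

/-- A decreasing order of an indicator vector lists the elements of the set first. -/
theorem prefixSet_card_eq {σ : Equiv.Perm (Fin d)} {X : Finset (Fin d)}
    (hσ : IsDecreasingOrder σ (indVec X)) : prefixSet σ X.card = X := by
  have hcard : X.card ≤ d := by simpa using Finset.card_le_univ X
  refine (Finset.eq_of_subset_of_card_le ?_ (card_prefixSet σ hcard).le).symm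
  intro i hi
  have hsub : prefixSet σ ((σ.symm i : Fin d) + 1) ⊆ X := by
    intro j hj
    rw [mem_prefixSet] at hj
    have hle : σ.symm j ≤ σ.symm i := Fin.le_def.2 (by omega)
    have h := hσ hle
    simp only [Equiv.apply_symm_apply, indVec_apply, hi, if_true] at h
    by_contra hjX
    rw [if_neg hjX] at h
    linarith
  have h := Finset.card_le_card hsub
  rw [card_prefixSet σ (σ.symm i).isLt] at h
  rw [mem_prefixSet]
  omega

theorem inner_indVec (s : Vec d) (X : Finset (Fin d)) :
    inner ℝ s (indVec X) = ∑ i ∈ X, s i := by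
  simp [PiLp.inner_apply, indVec_apply]

theorem norm_sub_indVec_sq_le (X Y : Finset (Fin d)) : ‖indVec X - indVec Y‖ ^ 2 ≤ d := by
  rw [EuclideanSpace.norm_sq_eq]
  have h : ∀ i ∈ Finset.univ, ‖(indVec X - indVec Y) i‖ ^ 2 ≤ (1 : ℝ) := by
    intro i _
    rw [PiLp.sub_apply, indVec_apply, indVec_apply]
    split_ifs <;> norm_num
  simpa using Finset.sum_le_sum h

/-! ### Greedy vectors and the Lovász extension -/

theorem greedyVec_apply (F : SetFun d) (σ : Equiv.Perm (Fin d)) (k : Fin d) :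
    greedyVec F σ (σ k) = marginalGain F (σ k) (prefixSet σ k) := by
  simp [greedyVec]

theorem lovaszSum_eq_inner_greedyVec (F : SetFun d) (σ : Equiv.Perm (Fin d)) (x : Vec d) :
    lovaszSum F σ x = inner ℝ (greedyVec F σ) x := by
  rw [PiLp.inner_apply, ← Equiv.sum_comp σ]
  refine Finset.sum_congr rfl fun k _ => ?_
  rw [greedyVec_apply]
  simp

/-- The Lovász extension is linear on the cone of vectors with a common decreasing order. -/
theorem lovasz_eq_inner_greedyVec (F : SetFun d) {σ : Equiv.Perm (Fin d)} {x : Vec d}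
    (hσ : IsDecreasingOrder σ x) : lovasz F x = inner ℝ (greedyVec F σ) x := by
  rw [lovasz_eq F x σ hσ, lovaszSum_eq_inner_greedyVec]

theorem sum_greedyVec_prefixSet {F : SetFun d} (hF : IsNormalized F) (σ : Equiv.Perm (Fin d))
    {n : ℕ} (hn : n ≤ d) : ∑ i ∈ prefixSet σ n, greedyVec F σ i = F (prefixSet σ n) := by
  induction n with
  | zero => simpa [prefixSet_zero] using hF.symm
  | succ n ih =>
    have h := insert_prefixSet σ ⟨n, hn⟩
    have h' := apply_notMem_prefixSet σ ⟨n, hn⟩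
    have h₂ := greedyVec_apply F σ ⟨n, hn⟩
    simp only at h h' h₂
    rw [← h, Finset.sum_insert h', ih (by omega), h₂, marginalGain]
    ring

theorem inner_greedyVec_indVec_prefixSet {F : SetFun d} (hF : IsNormalized F)
    (σ : Equiv.Perm (Fin d)) {n : ℕ} (hn : n ≤ d) :
    inner ℝ (greedyVec F σ) (indVec (prefixSet σ n)) = F (prefixSet σ n) := by
  rw [inner_indVec, sum_greedyVec_prefixSet hF σ hn]

/-- The greedy vector of a submodular function lies in its submodular polyhedron. -/
theorem sum_greedyVec_le {F : SetFun d} (hF : IsNormalized F) (hsub : IsSubmodular F)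
    (σ : Equiv.Perm (Fin d)) (S : Finset (Fin d)) : ∑ i ∈ S, greedyVec F σ i ≤ F S := by
  have key : ∀ n ≤ d, ∑ i ∈ S ∩ prefixSet σ n, greedyVec F σ i ≤ F (S ∩ prefixSet σ n) := by
    intro n
    induction n with
    | zero => intro _; simpa [prefixSet_zero] using hF.symm.le
    | succ n ih =>
      intro hn
      have hins := insert_prefixSet σ ⟨n, hn⟩
      have hmem := apply_notMem_prefixSet σ ⟨n, hn⟩
      have hval := greedyVec_apply F σ ⟨n, hn⟩
      simp only at hins hmem hval
      rw [← hins]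
      by_cases hS : σ ⟨n, hn⟩ ∈ S
      · rw [Finset.inter_insert_of_mem hS,
          Finset.sum_insert (fun h => hmem (Finset.mem_of_mem_inter_right h)), hval]
        have h := hsub (S ∩ prefixSet σ n) (prefixSet σ n) Finset.inter_subset_right _ hmem
        have h₂ := ih (by omega)
        simp only [marginalGain] at h ⊢
        linarith
      · rw [Finset.inter_insert_of_notMem hS]
        exact ih (by omega)
  simpa [prefixSet_top] using key d le_rfl

/-- Summation by parts: pairing a decreasing sequence with the increments of a nonnegative
sequence that vanishes at both ends gives a nonnegative number. -/
theorem sum_antitone_mul_increment_nonneg {a : Fin d → ℝ} (ha : Antitone a) {D : ℕ → ℝ}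
    (hD : ∀ n, 0 ≤ D n) (h0 : D 0 = 0) (hd : D d = 0) :
    0 ≤ ∑ k : Fin d, a k * (D (k + 1) - D k) := by
  cases d with
  | zero => simp
  | succ m =>
    have key : ∀ n (hn : n < m + 1), a ⟨n, hn⟩ * D (n + 1) ≤
        ∑ k : Fin (n + 1), a ⟨k, by omega⟩ * (D (k + 1) - D k) := by
      intro n
      induction n with
      | zero => intro _; simp [h0]
      | succ n ih =>
        intro hn
        rw [Fin.sum_univ_castSucc]
        have h := ih (by omega)
        have hle : a ⟨n + 1, hn⟩ ≤ a ⟨n, by omega⟩ := ha (Fin.mk_le_mk.2 (Nat.le_succ n))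
        have hmul := mul_le_mul_of_nonneg_right hle (hD (n + 1))
        simp only [Fin.val_castSucc, Fin.val_last]
        linarith
    have h := key m (Nat.lt_succ_self m)
    rwa [hd, mul_zero] at h

/-- Every greedy vector of a submodular function minorizes the Lovász extension. -/
theorem inner_greedyVec_le_lovasz {F : SetFun d} (hF : IsNormalized F) (hsub : IsSubmodular F)
    (σ : Equiv.Perm (Fin d)) (z : Vec d) : inner ℝ (greedyVec F σ) z ≤ lovasz F z := by
  have hτ := sortPerm_isDecreasingOrder z
  rw [lovasz]
  set τ := sortPerm z
  have h := sum_antitone_mul_increment_nonneg hτ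
    (D := fun n => F (prefixSet τ n) - ∑ i ∈ prefixSet τ n, greedyVec F σ i)
    (fun n => sub_nonneg.2 (sum_greedyVec_le hF hsub σ _))
    (by simpa [prefixSet_zero, IsNormalized] using hF)
    (by
      have := sum_greedyVec_prefixSet hF σ le_rfl
      rw [prefixSet_top] at this
      simp [prefixSet_top, this])
  have hinner : inner ℝ (greedyVec F σ) z = ∑ k : Fin d, z (τ k) * greedyVec F σ (τ k) := by
    rw [PiLp.inner_apply, ← Equiv.sum_comp τ]
    simp
  rw [hinner, lovaszSum, ← sub_nonneg, ← Finset.sum_sub_distrib]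
  refine h.trans_eq (Finset.sum_congr rfl fun k _ => ?_)
  simp only [← insert_prefixSet τ k, Finset.sum_insert (apply_notMem_prefixSet τ k), marginalGain]
  ring

/-- `ρ x + s(σ)` is a subgradient at `x` of the Lovász extension plus `(ρ/2)‖·‖²`. -/
theorem hReg_add_inner_le {F : SetFun d} (hF : IsNormalized F) (hsub : IsSubmodular F) {ρ : ℝ}
    (hρ : 0 ≤ ρ) {σ : Equiv.Perm (Fin d)} {x : Vec d} (hσ : IsDecreasingOrder σ x) (z : Vec d) :
    hReg F ρ x + inner ℝ (ρ • x + greedyVec F σ) (z - x) ≤ hReg F ρ z := by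
  have h₁ := inner_greedyVec_le_lovasz hF hsub σ z
  have h₂ := lovasz_eq_inner_greedyVec F hσ
  have h₃ : 0 ≤ ρ * ‖z - x‖ ^ 2 := by positivity
  rw [norm_sub_sq_real, real_inner_comm] at h₃
  simp only [hReg, inner_add_left, inner_sub_right, real_inner_smul_left,
    real_inner_self_eq_norm_sq]
  nlinarith

/-! ### The convex step -/

theorem gReg_of_mem (G : SetFun d) (ρ : ℝ) {x : Vec d} (hx : x ∈ cube d) :
    gReg G ρ x = (hReg G ρ x : EReal) := by
  simp [gReg, setIndicator, hx, hReg]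

theorem gReg_of_notMem (G : SetFun d) (ρ : ℝ) {x : Vec d} (hx : x ∉ cube d) :
    gReg G ρ x = ⊤ := by
  simp only [gReg, setIndicator, hx, if_false]
  rw [EReal.coe_add_top, EReal.top_add_coe]

theorem objective_of_mem (G H : SetFun d) (ρ : ℝ) {x : Vec d} (hx : x ∈ cube d) :
    objective G H ρ x = ((hReg G ρ x - hReg H ρ x : ℝ) : EReal) := by
  rw [objective, gReg_of_mem G ρ hx, EReal.coe_sub]

/-- If an approximate solution of the convex step improves the objective by at most `ε`, then the
current point is itself an approximate solution, with tolerance enlarged by `ε`. -/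
theorem isEpsSolution_of_objective_sub_le {G H : SetFun d} (hH0 : IsNormalized H)
    (hH : IsSubmodular H) {ρ εx ε : ℝ} (hρ : 0 ≤ ρ) {σ : Equiv.Perm (Fin d)} {x x' : Vec d}
    (hx : x ∈ cube d) (hσ : IsDecreasingOrder σ x)
    (hx' : IsEpsSolution (fun z => lovasz G z - inner ℝ z (ρ • x + greedyVec H σ)
      + ρ / 2 * ‖z‖ ^ 2) (cube d) εx x')
    (hobj : objective G H ρ x - objective G H ρ x' ≤ (ε : EReal)) :
    IsEpsSolution (fun z => lovasz G z - inner ℝ z (ρ • x + greedyVec H σ)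
      + ρ / 2 * ‖z‖ ^ 2) (cube d) (ε + εx) x := by
  refine ⟨hx, fun z hz => ?_⟩
  have h₁ := hReg_add_inner_le hH0 hH hρ hσ x'
  have h₂ := hx'.2 z hz
  rw [objective_of_mem G H ρ hx, objective_of_mem G H ρ hx'.1, ← EReal.coe_sub,
    EReal.coe_le_coe_iff] at hobj
  rw [inner_sub_right, real_inner_comm, real_inner_comm x] at h₁
  simp only [hReg] at h₁ hobj h₂ ⊢
  linarith

/-- Optimization over the step length `t`: the bound `ρ t d / 2 + a / t` is least at
`t = √(2 a / (ρ d))` if this is at most `1`, and at `t = 1` otherwise. -/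
theorem le_epsPrime_of_forall_step {ρ ε εx Δ : ℝ} (hρ : 0 ≤ ρ) (hε : 0 ≤ ε) (hεx : 0 ≤ εx)
    (h : ∀ t : ℝ, 0 ≤ t → t ≤ 1 → t * Δ ≤ ρ / 2 * t ^ 2 * d + (ε + εx)) :
    Δ ≤ epsPrime d ρ ε εx := by
  have h1 := h 1 zero_le_one le_rfl
  have hd : 0 ≤ ρ * d := by positivity
  set a := ε + εx with ha_def
  have ha : 0 ≤ a := by positivity
  unfold epsPrime
  split_ifs with hle
  · rw [← ha_def] at hle ⊢
    rcases hd.eq_or_lt with hd0 | hdpos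
    · rw [← hd0] at hle
      have : Δ ≤ 0 := by nlinarith
      exact this.trans (Real.sqrt_nonneg _)
    · rw [show 2 * ρ * d * a = 2 * (ρ * d) * a by ring]
      -- If `a = 0`, the optimal step length is `0`, where no information is left: a short
      -- positive step depending on `Δ` is needed instead.
      rcases ha.eq_or_lt with ha0 | hapos
      · rw [← ha0, mul_zero, Real.sqrt_zero]
        by_contra hΔ
        push Not at hΔ
        have hΔ' : Δ ≤ ρ * d / 2 := by nlinarith
        have ht := h (Δ / (ρ * d)) (by positivity) (by rw [div_le_one hdpos]; linarith)
        have e : Δ / (ρ * d) * Δ - ρ / 2 * (Δ / (ρ * d)) ^ 2 * d = Δ ^ 2 / (2 * (ρ * d)) := by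
          have : ρ ≠ 0 := left_ne_zero_of_mul hdpos.ne'
          have : (d : ℝ) ≠ 0 := right_ne_zero_of_mul hdpos.ne'
          field_simp
          ring
        have : 0 < Δ ^ 2 / (2 * (ρ * d)) := by positivity
        linarith
      · set r := √(2 * (ρ * d) * a) with hr
        have hrsq : r ^ 2 = 2 * (ρ * d) * a := Real.sq_sqrt (by positivity)
        have hrpos : 0 < r := Real.sqrt_pos.2 (by positivity)
        have hrle : r ≤ ρ * d := by
          refine Real.sqrt_le_iff.2 ⟨hd, ?_⟩
          nlinarith
        have ht := h (r / (ρ * d)) (by positivity) ((div_le_one hdpos).2 hrle)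
        have e : ρ / 2 * (r / (ρ * d)) ^ 2 * d + a = r / (ρ * d) * r := by
          have : ρ ≠ 0 := left_ne_zero_of_mul hdpos.ne'
          have : (d : ℝ) ≠ 0 := right_ne_zero_of_mul hdpos.ne'
          have hA : a = r ^ 2 / (2 * (ρ * d)) := by
            rw [hrsq]; field_simp
          rw [hA]
          field_simp
          ring
        rw [e] at ht
        exact le_of_mul_le_mul_left ht (by positivity)
  · linarith

/-- An indicator vector that approximately solves its own convex step is an approximate minimizer
of `G - H` among the prefixes of the order. -/
theorem le_prefixSet_of_isEpsSolution {G H : SetFun d} (hG0 : IsNormalized G)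
    (hH0 : IsNormalized H) {ρ εx ε : ℝ} (hρ : 0 ≤ ρ) (hεx : 0 ≤ εx) (hε : 0 ≤ ε)
    {σ : Equiv.Perm (Fin d)} {X : Finset (Fin d)} (hσ : IsDecreasingOrder σ (indVec X))
    (hsol : IsEpsSolution (fun z => lovasz G z - inner ℝ z (ρ • indVec X + greedyVec H σ)
      + ρ / 2 * ‖z‖ ^ 2) (cube d) (ε + εx) (indVec X)) {ℓ : ℕ} (hℓ : ℓ ≤ d) :
    G X - H X ≤ G (prefixSet σ ℓ) - H (prefixSet σ ℓ) + epsPrime d ρ ε εx := by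
  have hXd : X.card ≤ d := by simpa using Finset.card_le_univ X
  have hX := prefixSet_card_eq hσ
  have hGX := inner_greedyVec_indVec_prefixSet hG0 σ hXd
  have hHX := inner_greedyVec_indVec_prefixSet hH0 σ hXd
  have hGS := inner_greedyVec_indVec_prefixSet hG0 σ hℓ
  have hHS := inner_greedyVec_indVec_prefixSet hH0 σ hℓ
  have hw := isDecreasingOrder_indVec_prefixSet σ ℓ
  have hwc := indVec_mem_cube (prefixSet σ ℓ)
  have hnorm := norm_sub_indVec_sq_le (prefixSet σ ℓ) X
  rw [hX] at hGX hHX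
  set w := indVec (prefixSet σ ℓ)
  set x := indVec X
  suffices (G X - H X) - (G (prefixSet σ ℓ) - H (prefixSet σ ℓ)) ≤ epsPrime d ρ ε εx by linarith
  refine le_epsPrime_of_forall_step hρ hε hεx fun t ht0 ht1 => ?_
  have hzapp : ∀ i, (x + t • (w - x)) i = (1 - t) * x i + t * w i := by
    intro i
    simp only [PiLp.add_apply, PiLp.smul_apply, PiLp.sub_apply, smul_eq_mul]
    ring
  have hzσ : IsDecreasingOrder σ (x + t • (w - x)) := by
    intro a b hab
    simp only [hzapp]
    exact add_le_add (mul_le_mul_of_nonneg_left (hσ hab) (by linarith))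
      (mul_le_mul_of_nonneg_left (hw hab) ht0)
  have hzc : x + t • (w - x) ∈ cube d := by
    intro i
    obtain ⟨h₁, h₂⟩ := hsol.1 i
    obtain ⟨h₃, h₄⟩ := hwc i
    rw [hzapp]
    constructor <;> nlinarith
  have h := hsol.2 _ hzc
  simp only [lovasz_eq_inner_greedyVec G hzσ, lovasz_eq_inner_greedyVec G hσ] at h
  rw [norm_add_sq_real, norm_smul, mul_pow, Real.norm_eq_abs, sq_abs,
    real_inner_comm (ρ • x + greedyVec H σ), real_inner_comm (ρ • x + greedyVec H σ)] at h
  simp only [inner_add_left, inner_add_right, real_inner_smul_left, real_inner_smul_right] at h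
  rw [inner_sub_right (greedyVec G σ), inner_sub_right (greedyVec H σ), hGX, hGS, hHX, hHS] at h
  have hq : ρ / 2 * t ^ 2 * ‖w - x‖ ^ 2 ≤ ρ / 2 * t ^ 2 * d :=
    mul_le_mul_of_nonneg_left hnorm (by positivity)
  linarith

/-! ### Candidates from the conjugate -/

theorem le_conjugate (Φ : Vec d → EReal) (x y : Vec d) :
    ((inner ℝ x y : ℝ) : EReal) - Φ x ≤ conjugate Φ y :=
  le_iSup (fun x : Vec d => ((inner ℝ x y : ℝ) : EReal) - Φ x) x

theorem conjugate_gReg_le_iff (G : SetFun d) (ρ c : ℝ) (y : Vec d) :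
    conjugate (gReg G ρ) y ≤ (c : EReal) ↔ ∀ z ∈ cube d, inner ℝ z y - hReg G ρ z ≤ c := by
  rw [conjugate, iSup_le_iff]
  refine forall_congr' fun z => ?_
  by_cases hz : z ∈ cube d
  · rw [gReg_of_mem G ρ hz, ← EReal.coe_sub, EReal.coe_le_coe_iff]
    simp [hz]
  · rw [gReg_of_notMem G ρ hz]
    simp [hz]

/-- An `ε_x`-subgradient of `g*` at `y` is an `ε_x`-solution of the convex step with linear
term `y`. -/
theorem isEpsSolution_of_mem_epsSubdiff_conjugate {G : SetFun d} (hG0 : IsNormalized G)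
    (hG : IsSubmodular G) {ρ εx : ℝ} (hρ : 0 ≤ ρ) {x' y : Vec d}
    (hx' : x' ∈ epsSubdiff (conjugate (gReg G ρ)) εx y) :
    IsEpsSolution (fun z => lovasz G z - inner ℝ z y + ρ / 2 * ‖z‖ ^ 2) (cube d) εx x' := by
  obtain ⟨hlt, hsub⟩ := hx'
  have h0 : (0 : Vec d) ∈ cube d := fun i => by simp
  have hbot : conjugate (gReg G ρ) y ≠ ⊥ := by
    intro hb
    have h := le_conjugate (gReg G ρ) 0 y
    rw [gReg_of_mem G ρ h0, ← EReal.coe_sub, hb, le_bot_iff] at h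
    exact EReal.coe_ne_bot _ h
  obtain ⟨c, hc⟩ : ∃ c : ℝ, conjugate (gReg G ρ) y = (c : EReal) :=
    ⟨_, (EReal.coe_toReal hlt.ne hbot).symm⟩
  have hyc := (conjugate_gReg_le_iff G ρ c y).1 hc.le
  have htest : ∀ (y' : Vec d) (c' : ℝ), (∀ z ∈ cube d, inner ℝ z y' - hReg G ρ z ≤ c') →
      c + (inner ℝ x' (y' - y) - εx) ≤ c' := by
    intro y' c' h
    have h₂ := (hsub y').trans ((conjugate_gReg_le_iff G ρ c' y').2 h)
    rwa [hc, ← EReal.coe_add, EReal.coe_le_coe_iff] at h₂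
  -- Moving `y` by `t` along a coordinate axis raises `g*` by at most `max t 0`, the support
  -- function of the cube; letting `t → ±∞` confines each coordinate of `x'` to `[0, 1]`.
  have haxis : ∀ (i : Fin d) (t b : ℝ), (∀ z ∈ cube d, t * z i ≤ b) → t * x' i - εx ≤ b := by
    intro i t b hb
    have h := htest (y + EuclideanSpace.single i t) (c + b) (fun z hz => by
      have h₁ := hyc z hz
      have h₂ := hb z hz
      rw [inner_add_right, EuclideanSpace.inner_single_right]
      simp only [conj_trivial]
      linarith)
    rw [add_sub_cancel_left, EuclideanSpace.inner_single_right] at h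
    simp only [conj_trivial] at h
    linarith
  have hx'c : x' ∈ cube d := by
    intro i
    constructor
    · by_contra! hneg
      have h := haxis i ((|εx| + 1) / x' i) 0 (fun z hz =>
        mul_nonpos_of_nonpos_of_nonneg
          (div_nonpos_of_nonneg_of_nonpos (by positivity) hneg.le) (hz i).1)
      rw [div_mul_cancel₀ _ hneg.ne] at h
      linarith [le_abs_self εx]
    · by_contra! hgt
      have hpos : 0 < x' i - 1 := by linarith
      have hnn : 0 ≤ (|εx| + 1) / (x' i - 1) := by positivity
      have h := haxis i ((|εx| + 1) / (x' i - 1)) ((|εx| + 1) / (x' i - 1)) (fun z hz =>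
        mul_le_of_le_one_right hnn (hz i).2)
      have e : (|εx| + 1) / (x' i - 1) * (x' i - 1) = |εx| + 1 := div_mul_cancel₀ _ hpos.ne'
      linarith [le_abs_self εx]
  refine ⟨hx'c, fun z hz => ?_⟩
  -- At a subgradient `y'` of `g` at `x'`, the conjugate is `⟨x', y'⟩ - g x'`.
  have hτ := sortPerm_isDecreasingOrder x'
  have h := htest (ρ • x' + greedyVec G (sortPerm x'))
    (inner ℝ x' (ρ • x' + greedyVec G (sortPerm x')) - hReg G ρ x') (fun u _ => by
      have hu := hReg_add_inner_le hG0 hG hρ hτ u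
      rw [inner_sub_right, real_inner_comm, real_inner_comm x'] at hu
      linarith)
  have hzc := hyc z hz
  rw [inner_sub_right] at h
  simp only [hReg] at h hzc ⊢
  linarith

end DSMin

open DSMin
theorem corollary1 (d : ℕ) (G H : SetFun d)
    (hG0 : IsNormalized G) (hH0 : IsNormalized H) (hG : IsSubmodular G) (hH : IsSubmodular H)
    (ρ εx : ℝ) (hρ : 0 ≤ ρ) (hεx : 0 ≤ εx) (N : ℕ∞) :
    (∀ (x y : ℕ → Vec d) (X : ℕ → Finset (Fin d)) (σ : ℕ → Equiv.Perm (Fin d)),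
      IsGreedyDCARun G H ρ εx N x y X σ →
      ∀ (k : ℕ) (ε : ℝ), (k : ℕ∞) < N → 0 ≤ ε →
        objective G H ρ (x k) - objective G H ρ (x (k + 1)) ≤ (ε : EReal) →
        ∀ ℓ : ℕ, ℓ ≤ d →
          G (X k) - H (X k) ≤
            G (prefixSet (σ k) ℓ) - H (prefixSet (σ k) ℓ) + epsPrime d ρ ε εx) ∧
    (∀ (x : ℕ → Vec d) (y xc : ℕ → Fin d → Vec d) (X : ℕ → Finset (Fin d))
      (σ : ℕ → Fin d → Equiv.Perm (Fin d)),
      IsMultiGreedyDCARun G H ρ εx N x y xc X σ →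
      ∀ (k : ℕ) (ε : ℝ), (k : ℕ∞) < N → 0 ≤ ε →
        objective G H ρ (x k) - objective G H ρ (x (k + 1)) ≤ (ε : EReal) →
        (∀ (i : Fin d) (ℓ : ℕ), ℓ ≤ d →
          G (X k) - H (X k) ≤
            G (prefixSet (σ k i) ℓ) - H (prefixSet (σ k i) ℓ) + epsPrime d ρ ε εx) ∧
        IsEpsLocalMin (fun S => G S - H S) (epsPrime d ρ ε εx) (X k)) := by
  have core : ∀ (X : Finset (Fin d)) (σ : Equiv.Perm (Fin d)) (y x' : Vec d) (ε : ℝ), 0 ≤ ε →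
      IsDecreasingOrder σ (indVec X) → y - ρ • indVec X = greedyVec H σ →
      IsEpsSolution (fun z => lovasz G z - inner ℝ z y + ρ / 2 * ‖z‖ ^ 2) (cube d) εx x' →
      objective G H ρ (indVec X) - objective G H ρ x' ≤ (ε : EReal) → ∀ ℓ : ℕ, ℓ ≤ d →
      G X - H X ≤ G (prefixSet σ ℓ) - H (prefixSet σ ℓ) + epsPrime d ρ ε εx := by
    intro X σ y x' ε hε hσ hy hsol hobj ℓ hℓ
    obtain rfl : y = ρ • indVec X + greedyVec H σ := by rw [← hy]; abel
    exact le_prefixSet_of_isEpsSolution hG0 hH0 hρ hεx hε hσ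
      (isEpsSolution_of_objective_sub_le hH0 hH hρ (indVec_mem_cube X) hσ hsol hobj) hℓ
  refine ⟨?_, ?_⟩
  · intro x y X σ hrun k ε hk hε hobj
    have hx := hrun.integral k hk
    have hσ := hrun.order k hk
    have hy := hrun.greedy k hk
    rw [hx] at hσ hy hobj
    exact core _ _ _ _ ε hε hσ hy (hrun.step k hk) hobj
  · intro x y xc X σ hrun k ε hk hε hobj
    have hx := hrun.integral k hk
    obtain ⟨i₀, hi₀, hbest⟩ := hrun.best k hk
    have hσ : ∀ i, IsDecreasingOrder (σ k i) (indVec (X k)) := fun i => hx ▸ hrun.order k hk i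
    rw [hx, hi₀] at hobj
    have hmain : ∀ (i : Fin d) (ℓ : ℕ), ℓ ≤ d → G (X k) - H (X k) ≤
        G (prefixSet (σ k i) ℓ) - H (prefixSet (σ k i) ℓ) + epsPrime d ρ ε εx := by
      intro i
      refine core _ _ (y k i) (xc k i) ε hε (hσ i) (hx ▸ hrun.greedy k hk i)
        (isEpsSolution_of_mem_epsSubdiff_conjugate hG0 hG hρ (hrun.candidate k hk i)) ?_
      exact (EReal.sub_le_sub le_rfl (hbest i)).trans hobj
    obtain ⟨hin, hout⟩ := hrun.covers k hk
    refine ⟨hmain, fun j hj => ?_, fun j hj => ?_⟩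
    · obtain ⟨i, p, hp, rfl⟩ := hout j hj
      have h := hmain i (p + 1) p.isLt
      rwa [← insert_prefixSet, hp, prefixSet_card_eq (hσ i)] at h
    · obtain ⟨i, p, hp, rfl⟩ := hin j hj
      have hX : insert (σ k i p) (prefixSet (σ k i) p) = X k := by
        rw [insert_prefixSet, hp, prefixSet_card_eq (hσ i)]
      have h := hmain i p p.isLt.le
      have he : (X k).erase (σ k i p) = prefixSet (σ k i) p := by
        rw [← hX, Finset.erase_insert (apply_notMem_prefixSet _ _)]
      simpa only [he] using h
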